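/- Let $V$ be a finite set, $d\ge 0$, and let $\sigma_1,\dots,\sigma_d$ be permutations of $V$. Write $G(\sigma_1,\dots,\sigma_d)$ for the $2d$-regular undirected multigraph on $V$ with one edge $\{v,\sigma_i(v)\}$ for each $v\in V$ and each $i\in\{1,\dots,d\}$; parallel edges and loops are allowed, and in the adjacency matrix a loop at $v$ contributes $2$ to the diagonal entry. Fix the base graph $G_B=G(\sigma_1,\dots,\sigma_d)$. For $n\in\mathbb N$ choose $\pi_1,\dots,\pi_d\in S_n$ independently and uniformly at random, and let $H=G((\sigma_1,\pi_1),\dots,(\sigma_d,\pi_d))$ be the random multigraph on $V\times\{1,\dots,n\}$, where $(\sigma_i,\pi_i)$ acts by $(v,u)\mapsto(\sigma_i(v),\pi_i(u))$. The new eigenvalues of $H$ are those eigenvalues of its adjacency matrix, counted with multiplicity, that remain after the eigenvalues of $G_B$ (counted with multiplicity) have been removed. Let $\mu(H)$ be the largest absolute value of a new eigenvalue of $H$ (and $0$ if there are none). **Theorem.** For every $d$, every finite $V$ and all fixed $\sigma_1,\dots,\sigma_d$, $$\mathbb E[\mu(H)]\le 32^{1/4}\,d^{3/4}+o(1)\qquad(n\to\infty).$$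 Moreover $\mu(H)=O(d^{3/4})$ asymptotically almost surely: there is an absolute constant $C$, independent of $d$, $V$ and $\sigma_1,\dots,\sigma_d$, such that for every $d$, $V$ and $\sigma_1,\dots,\sigma_d$, $$\lim_{n\to\infty}\Pr\bigl[\mu(H)\le C\,d^{3/4}\bigr]=1 .$$ -/

import Mathlib

open Filter Topology

namespace TightProduct

/-- The undirected multigraph `G(σ₁, …, σ_d)` on `V`: it has one edge `(i, v)`, with ends `v` and
`σᵢ(v)`, for every `i ∈ [d]` and every `v ∈ V`. Parallel edges and loops are allowed. -/
def permGraph {V : Type*} {d : ℕ} (σ : Fin d → Equiv.Perm V) : Graph V (Fin d × V) where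
  vertexSet := Set.univ
  IsLink e x y := s(e.2, σ e.1 e.2) = s(x, y)
  isLink_symm _ _ := ⟨fun _ _ h => h.trans Sym2.eq_swap⟩
  eq_or_eq_of_isLink_of_isLink := by
    intro e x y v w h h'
    rcases Sym2.eq_iff.1 (h.symm.trans h') with h'' | h''
    · exact Or.inl h''.1
    · exact Or.inr h''.1
  left_mem_of_isLink := by
    intros
    exact Set.mem_univ _

open Classical in
/-- The adjacency matrix of a multigraph: the `(x, y)` entry is the number of edges between `x`
and `y`, where a loop at `x` contributes `2` to the diagonal entry (a loop is counted twice). -/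
noncomputable def adjacencyMatrix {V E : Type*} (G : Graph V E) : Matrix V V ℝ :=
  Matrix.of fun x y => (if x = y then 2 else 1) * (Nat.card {e : E // G.IsLink e x y} : ℝ)

/-- The adjacency matrix of `G(σ₁, …, σ_d)` counts, at `(x, y)`, the indices `i` with `σᵢ(x) = y`
plus the indices `i` with `σᵢ⁻¹(x) = y`. -/
theorem adjacencyMatrix_permGraph {V : Type*} [Fintype V] [DecidableEq V] {d : ℕ}
    (σ : Fin d → Equiv.Perm V) :
    adjacencyMatrix (permGraph σ)
      = ∑ i, ((σ i).permMatrix ℝ + ((σ i)⁻¹).permMatrix ℝ) := by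
  have key : ∀ (τ : Equiv.Perm V) (x y : V),
      (if x = y then (2 : ℝ) else 1) * ∑ v, (if s(v, τ v) = s(x, y) then (1 : ℝ) else 0)
        = (if τ x = y then 1 else 0) + (if τ⁻¹ x = y then 1 else 0) := by
    intro τ x y
    have hinv : τ⁻¹ x = y ↔ τ y = x := by
      rw [Equiv.Perm.inv_eq_iff_eq, eq_comm]
    by_cases hxy : x = y
    · subst hxy
      have h : ∀ v, (if s(v, τ v) = s(x, x) then (1 : ℝ) else 0)
          = if v = x then (if τ x = x then 1 else 0) else 0 := by
        intro v
        by_cases hv : v = x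
        · subst hv; simp
        · simp [hv]
      simp only [h, hinv, Finset.sum_ite_eq', Finset.mem_univ, if_true]
      ring
    · have h : ∀ v, (if s(v, τ v) = s(x, y) then (1 : ℝ) else 0)
          = (if v = x then (if τ x = y then 1 else 0) else 0)
            + (if v = y then (if τ y = x then 1 else 0) else 0) := by
        intro v
        by_cases hv : v = x
        · subst hv; simp [hxy]
        · by_cases hv' : v = y
          · subst hv'; simp [hv]
          · simp [hv, hv']
      simp only [h, hinv, Finset.sum_add_distrib, Finset.sum_ite_eq', Finset.mem_univ, if_true,
        if_neg hxy, one_mul]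
  ext x y
  have hcard : (Nat.card {e : Fin d × V // (permGraph σ).IsLink e x y} : ℝ)
      = ∑ i, ∑ v, (if s(v, σ i v) = s(x, y) then (1 : ℝ) else 0) := by
    have h1 : Nat.card {e : Fin d × V // (permGraph σ).IsLink e x y}
        = Fintype.card {e : Fin d × V // s(e.2, σ e.1 e.2) = s(x, y)} := by
      rw [← Nat.card_eq_fintype_card]
      rfl
    rw [h1, Fintype.card_subtype, Finset.card_filter, Fintype.sum_prod_type]
    push_cast
    rfl
  rw [adjacencyMatrix, Matrix.of_apply, hcard, Matrix.sum_apply, Finset.mul_sum]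
  refine Finset.sum_congr rfl fun i _ => ?_
  have hk := key (σ i) x y
  rw [Matrix.add_apply]
  simp only [Equiv.Perm.permMatrix, PEquiv.toMatrix_apply, Equiv.toPEquiv_apply, Option.mem_def,
    Option.some.injEq]
  convert hk using 2
  split_ifs <;> rfl

/-- The spectrum of a finite multigraph: the eigenvalues of its (real symmetric) adjacency matrix,
listed with multiplicity. -/
noncomputable def spectrum {V E : Type*} [Fintype V] [DecidableEq V] (G : Graph V E) :
    Multiset ℝ :=
  (adjacencyMatrix G).charpoly.roots

/-- The new eigenvalues of a covering graph `H` of a base graph `G`, with multiplicity: what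
remains of the spectrum of `H` after the old eigenvalues (those of `G`) have been removed. -/
noncomputable def newEigenvalues {W F V E : Type*} [Fintype W] [DecidableEq W] [Fintype V]
    [DecidableEq V] (H : Graph W F) (G : Graph V E) : Multiset ℝ :=
  spectrum H - spectrum G

/-- `μ(H)`: the largest absolute value of a new eigenvalue of `H` (and `0` if there is no new
eigenvalue). -/
noncomputable def mu {W F V E : Type*} [Fintype W] [DecidableEq W] [Fintype V]
    [DecidableEq V] (H : Graph W F) (G : Graph V E) : ℝ :=
  ((newEigenvalues H G).map (fun x => |x|)).fold max 0

/-- The product graph `H = G((σ₁, π₁), …, (σ_d, π_d))` on `V × [n]`, where `(σᵢ, πᵢ)` is the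
permutation `(v, u) ↦ (σᵢ v, πᵢ u)`. -/
def productGraph {V : Type*} {d n : ℕ} (σ : Fin d → Equiv.Perm V)
    (π : Fin d → Equiv.Perm (Fin n)) : Graph (V × Fin n) (Fin d × (V × Fin n)) :=
  permGraph fun i => (σ i).prodCongr (π i)

/-- `μ(H)` for the product `H` of `G_B = G(σ₁, …, σ_d)` with `G(π₁, …, π_d)`; old and new refer
to the base graph `G_B`. -/
noncomputable def muProduct {V : Type*} [Fintype V] [DecidableEq V] {d n : ℕ}
    (σ : Fin d → Equiv.Perm V) (π : Fin d → Equiv.Perm (Fin n)) : ℝ :=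
  mu (productGraph σ π) (permGraph σ)

/-- The expectation of a real function of independent, uniformly random permutations
`π₁, …, π_d ∈ S_n`, that is, of a uniformly random `d`-tuple. -/
noncomputable def expectation {d n : ℕ} (f : (Fin d → Equiv.Perm (Fin n)) → ℝ) : ℝ :=
  (∑ π, f π) / Fintype.card (Fin d → Equiv.Perm (Fin n))

/-- The probability of an event for independent, uniformly random permutations
`π₁, …, π_d ∈ S_n`. -/
noncomputable def probability {d n : ℕ} (p : (Fin d → Equiv.Perm (Fin n)) → Prop) : ℝ :=
  Nat.card {π // p π} / Fintype.card (Fin d → Equiv.Perm (Fin n))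

end TightProduct

/-! The proof is the trace method. For a word `w` of length `2k` in the letters and their inverses,
`(σ, π)` evaluates to the product of `σ(w)` and `π(w)`, so the `2k`-th powers of the new eigenvalues
sum to `∑_w fix(σ(w)) (fix(π(w)) - 1)`, which dominates `μ ^ (2k)` (`muProduct_pow_le`). The base
graph enters only through `fix(σ(w)) ≤ |V|`.

Words are split by the element they spell in the free group. Proper powers, including `1`, may fix
all `n` points, but there are at most `(2k+1)^3 (8d)^k` such words (`card_isProperPower_words_le`).
Any other element has at most `1 + O(k^4/n)` expected fixed points (`sum_fixCount_le`): a closed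
trail needs either a first return exactly at its last step, of probability about `1/n`, or two
independent coincidences, of probability `O(k^4/n^2)`.

Hence `E[μ^(2k)] ≤ |V| (poly(k) (8d)^k n + (2d)^(2k) O(k^4)/n)`. The two terms balance at `n^2 ≈
(d/2)^k`, where both are `(32 d^3)^(k/2)` up to factors polynomial in `k`; the `2k`-th root is
`32^(1/4) d^(3/4)`. Jensen gives the expectation and Markov the probability. For `d ≤ 2` the trivial
bound `2d` already suffices. -/

namespace TightProduct

/-! ### Counting words that spell proper powers in a free group -/

section FreeGroupWords

open FreeGroup

variable {α : Type*} [DecidableEq α]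

/-- `g` is a power with exponent different from one (in particular `g = 1` is allowed). -/
def IsProperPower {G : Type*} [Group G] (g : G) : Prop :=
  ∃ (h : G) (j : ℕ), j ≠ 1 ∧ g = h ^ j

theorem isProperPower_of_mem_zpowers {G : Type*} [Group G] {g h : G}
    (hg : g ∈ Subgroup.zpowers h) : IsProperPower g ∨ g = h ∨ g = h⁻¹ := by
  obtain ⟨j, rfl⟩ := Subgroup.mem_zpowers_iff.1 hg
  obtain ⟨n, rfl | rfl⟩ := j.eq_nat_or_neg
  · by_cases hn : n = 1
    · subst hn; simp
    · exact Or.inl ⟨h, n, hn, by simp⟩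
  · by_cases hn : n = 1
    · subst hn; simp
    · exact Or.inl ⟨h⁻¹, n, hn, by simp⟩

theorem IsProperPower.conj {G : Type*} [Group G] {g : G} (u : G) (hg : IsProperPower g) :
    IsProperPower (u * g * u⁻¹) := by
  obtain ⟨h, j, hj, rfl⟩ := hg
  exact ⟨u * h * u⁻¹, j, hj, by rw [conj_pow]⟩

/-- Cyclic reduction `h = u v u⁻¹` gives `|h^j| = 2|u| + j|v|`, and `j ≥ 2` unless `h^j = 1`. So a
proper power is described by data of half its length, which is where the saving in the count comes
from. -/
theorem exists_conj_of_isProperPower {g : FreeGroup α} (hg : IsProperPower g) :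
    ∃ (u v : List (α × Bool)) (i : ℕ), g = mk u * mk v ^ i * (mk u)⁻¹ ∧ i ≤ norm g ∧
      2 * (u.length + v.length) ≤ norm g := by
  obtain ⟨h, j, hj, rfl⟩ := hg
  by_cases h1 : h ^ j = 1
  · exact ⟨[], [], 0, by simp [h1, ← one_eq_mk], by simp, by simp⟩
  have hj0 : j ≠ 0 := by rintro rfl; simp at h1
  have hh1 : h ≠ 1 := by rintro rfl; simp at h1
  set u := reduceCyclically.conjugator h.toWord
  set v := reduceCyclically h.toWord
  have hu : u ++ v ++ invRev u = h.toWord := reduceCyclically.conj_conjugator_reduceCyclically _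
  have hh : h = mk u * mk v * (mk u)⁻¹ := by
    rw [inv_mk, mul_mk, mul_mk, hu, mk_toWord]
  have hv : v ≠ [] := by
    intro hv
    rw [hv, ← one_eq_mk, mul_one, mul_inv_cancel] at hh
    exact hh1 hh
  have hnorm : norm (h ^ j) = 2 * u.length + j * v.length := by
    rw [FreeGroup.norm, toWord_pow, reduceCyclically.reduce_flatten_replicate isReduced_toWord,
      if_neg hj0]
    simp [u, v]
    ring
  have hvl : 1 ≤ v.length := List.length_pos_iff.2 hv
  refine ⟨u, v, j, ?_, ?_, ?_⟩
  · rw [← conj_pow, ← hh]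
  · rw [hnorm]; nlinarith
  · rw [hnorm]
    have : 2 ≤ j := by omega
    nlinarith

theorem norm_mk_singleton_mul_of_ne {g : FreeGroup α} (a : α × Bool)
    (h : ∀ b ∈ g.toWord.head?, ¬ (a.1 = b.1 ∧ a.2 = !b.2)) :
    norm (mk [a] * g) = norm g + 1 := by
  have h1 : toWord (mk [a] * g) = reduce (a :: g.toWord) := by
    rw [toWord_mul, toWord_mk, reduce_singleton]; rfl
  rw [FreeGroup.norm, h1, reduce.cons, reduce_toWord, FreeGroup.norm]
  cases hw : g.toWord with
  | nil => simp
  | cons b l =>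
    have := h b (by simp [hw])
    simp [this]

theorem norm_le_norm_mk_singleton_mul (g : FreeGroup α) (a : α × Bool) :
    norm g ≤ norm (mk [a] * g) + 1 := by
  have h := norm_mul_le (mk [a])⁻¹ (mk [a] * g)
  rw [inv_mul_cancel_left, norm_inv_eq] at h
  have h2 : norm (mk [a]) ≤ 1 := norm_mk_le
  omega

variable [Fintype α]

/-- The number of words of length `L` in the letters and their inverses that represent `g`. -/
noncomputable def wordCount (L : ℕ) (g : FreeGroup α) : ℕ :=
  (Finset.univ.filter fun w : Fin L → α × Bool => mk (List.ofFn w) = g).card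

theorem wordCount_succ (L : ℕ) (g : FreeGroup α) :
    wordCount (L + 1) g = ∑ a : α × Bool, wordCount L ((mk [a])⁻¹ * g) := by
  simp only [wordCount, Finset.card_filter]
  rw [← Fintype.sum_prod_type', ← (Fin.consEquiv fun _ : Fin (L + 1) => α × Bool).sum_comp]
  refine Fintype.sum_congr _ _ fun p => ?_
  have h : mk (List.ofFn ((Fin.consEquiv fun _ : Fin (L + 1) => α × Bool) p))
      = mk [p.1] * mk (List.ofFn p.2) := by
    rw [mul_mk]; simp [Fin.consEquiv, List.ofFn_succ]
  simp only [h, eq_inv_mul_iff_mul_eq]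

/-- At most one letter, the first of `g`, can shorten `g` and costs a factor `r`; the others, at
most `r^2` many, lengthen it and cost `r⁻¹` each. Thus `r^(-|g|)` is a supersolution of the
recursion for `wordCount`. -/
theorem sum_inv_pow_norm_le {r : ℝ} (hr : 1 ≤ r) (hr2 : r ^ 2 = Fintype.card (α × Bool))
    (g : FreeGroup α) :
    ∑ a : α × Bool, (r⁻¹) ^ norm ((mk [a])⁻¹ * g) ≤ 2 * r * (r⁻¹) ^ norm g := by
  have hr0 : (0 : ℝ) < r := by linarith
  have hinv : r⁻¹ ≤ 1 := inv_le_one_of_one_le₀ hr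
  have key : ∀ a : α × Bool, (r⁻¹) ^ norm ((mk [a])⁻¹ * g)
      ≤ r⁻¹ * (r⁻¹) ^ norm g + if g.toWord.head? = some a then r * (r⁻¹) ^ norm g else 0 := by
    intro a
    have hinvmk : (mk [a])⁻¹ = mk [(a.1, !a.2)] := by simp [inv_mk, invRev]
    rw [hinvmk]
    split_ifs with h
    · have h1 := norm_le_norm_mk_singleton_mul g (a.1, !a.2)
      have h2 : (r⁻¹) ^ (norm (mk [(a.1, !a.2)] * g) + 1) ≤ (r⁻¹) ^ norm g :=
        pow_le_pow_of_le_one (by positivity) hinv h1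
      have h3 : (r⁻¹) ^ norm (mk [(a.1, !a.2)] * g)
          = r * (r⁻¹) ^ (norm (mk [(a.1, !a.2)] * g) + 1) := by
        rw [pow_succ]; field_simp
      have h4 : 0 ≤ r⁻¹ * (r⁻¹) ^ norm g := by positivity
      rw [h3]
      nlinarith
    · rw [norm_mk_singleton_mul_of_ne, pow_succ]
      · linarith
      · rintro b hb ⟨h1, h2⟩
        apply h
        rw [Option.mem_def] at hb
        rw [hb]
        simp only [Option.some.injEq]
        ext <;> simp_all
  refine (Finset.sum_le_sum fun a _ => key a).trans ?_
  rw [Finset.sum_add_distrib, Finset.sum_const, Finset.card_univ, nsmul_eq_mul, ← hr2]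
  have h5 : ∑ a : α × Bool, (if g.toWord.head? = some a then r * (r⁻¹) ^ norm g else 0)
      ≤ r * (r⁻¹) ^ norm g := by
    cases hg : g.toWord.head? with
    | none => simp; positivity
    | some b => simp [Finset.sum_ite_eq]
  have h6 : r ^ 2 * (r⁻¹ * (r⁻¹) ^ norm g) = r * (r⁻¹) ^ norm g := by
    field_simp
  rw [h6]
  linarith

theorem wordCount_le {r : ℝ} (hr : 1 ≤ r) (hr2 : r ^ 2 = Fintype.card (α × Bool)) (L : ℕ)
    (g : FreeGroup α) : (wordCount L g : ℝ) ≤ (2 * r) ^ L * (r⁻¹) ^ norm g := by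
  induction L generalizing g with
  | zero =>
    by_cases hg : g = 1
    · subst hg
      simp [wordCount, ← one_eq_mk]
    · have : wordCount 0 g = 0 := by
        simp [wordCount, ← one_eq_mk, Ne.symm hg]
      rw [this]
      have : 0 < r := by linarith
      simp; positivity
  | succ L ih =>
    rw [wordCount_succ]
    push_cast
    have h0 : (0 : ℝ) ≤ (2 * r) ^ L := by positivity
    calc ∑ a : α × Bool, (wordCount L ((mk [a])⁻¹ * g) : ℝ)
        ≤ ∑ a : α × Bool, (2 * r) ^ L * (r⁻¹) ^ norm ((mk [a])⁻¹ * g) :=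
          Finset.sum_le_sum fun a _ => ih _
      _ ≤ (2 * r) ^ L * (2 * r * (r⁻¹) ^ norm g) := by
          rw [← Finset.mul_sum]
          exact mul_le_mul_of_nonneg_left (sum_inv_pow_norm_le hr hr2 g) h0
      _ = _ := by ring

open Classical in
theorem card_isProperPower_words_le [Nonempty α] (k : ℕ) :
    ((Finset.univ.filter fun w : Fin (2 * k) → α × Bool =>
      IsProperPower (mk (List.ofFn w))).card : ℝ) ≤ (2 * k + 1) ^ 3 * (8 * Fintype.card α) ^ k := by
  set q : ℕ := Fintype.card (α × Bool) with hq
  have hq1 : 1 ≤ q := Fintype.card_pos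
  set r : ℝ := Real.sqrt q
  have hr : 1 ≤ r := Real.one_le_sqrt.2 (by exact_mod_cast hq1)
  have hr2 : r ^ 2 = q := Real.sq_sqrt (by positivity)
  have hr0 : 0 < r := by linarith
  have hq8 : ((2 * r) ^ (2 * k) : ℝ) = (8 * Fintype.card α) ^ k := by
    rw [pow_mul, mul_pow, hr2, hq, Fintype.card_prod, Fintype.card_bool]
    push_cast
    ring
  -- Here `p` records `|u|`, `|v|` and the exponent. There are `q^(|u|+|v|)` pairs `(u, v)`, each
  -- contributing at most `(2r)^(2k) r^(-2(|u|+|v|))` words; as `r^2 = q`, the lengths cancel and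
  -- `(8 * card α)^k` remains.
  let T (p : Fin (2 * k + 1) × Fin (2 * k + 1) × Fin (2 * k + 1)) :
      Finset (Fin (2 * k) → α × Bool) :=
    Finset.univ.biUnion fun u : Fin p.1 → α × Bool =>
      Finset.univ.biUnion fun v : Fin p.2.1 → α × Bool =>
        let g := mk (List.ofFn u) * mk (List.ofFn v) ^ (p.2.2 : ℕ) * (mk (List.ofFn u))⁻¹
        if 2 * ((p.1 : ℕ) + p.2.1) ≤ norm g then
          Finset.univ.filter fun w : Fin (2 * k) → α × Bool => mk (List.ofFn w) = g
        else ∅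
  have hT : ∀ p, ((T p).card : ℝ) ≤ (8 * Fintype.card α) ^ k := by
    intro p
    refine (Nat.cast_le.2 (Finset.card_biUnion_le.trans
      (Finset.sum_le_sum fun u _ => Finset.card_biUnion_le))).trans ?_
    push_cast
    have hb : ∀ (u : Fin p.1 → α × Bool) (v : Fin p.2.1 → α × Bool),
        ((if 2 * ((p.1 : ℕ) + p.2.1) ≤
            norm (mk (List.ofFn u) * mk (List.ofFn v) ^ (p.2.2 : ℕ) * (mk (List.ofFn u))⁻¹) then
          Finset.univ.filter fun w : Fin (2 * k) → α × Bool => mk (List.ofFn w) =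
            mk (List.ofFn u) * mk (List.ofFn v) ^ (p.2.2 : ℕ) * (mk (List.ofFn u))⁻¹
        else ∅).card : ℝ) ≤ (8 * Fintype.card α) ^ k * (r⁻¹) ^ (2 * ((p.1 : ℕ) + p.2.1)) := by
      intro u v
      split_ifs with h
      · refine (wordCount_le hr hr2 (2 * k) _).trans ?_
        rw [hq8]
        exact mul_le_mul_of_nonneg_left
          (pow_le_pow_of_le_one (by positivity) (inv_le_one_of_one_le₀ hr) h) (by positivity)
      · simp; positivity
    refine (Finset.sum_le_sum fun u _ => Finset.sum_le_sum fun v _ => hb u v).trans ?_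
    simp only [Finset.sum_const, Finset.card_univ, Fintype.card_fun, Fintype.card_fin, nsmul_eq_mul]
    rw [← hq, pow_mul, inv_pow, hr2]
    have hq0 : (q : ℝ) ≠ 0 := by positivity
    apply le_of_eq
    push_cast
    rw [inv_pow, pow_add]
    field_simp
  have hsub : (Finset.univ.filter fun w : Fin (2 * k) → α × Bool =>
      IsProperPower (mk (List.ofFn w))) ⊆ Finset.univ.biUnion T := by
    intro w hw
    rw [Finset.mem_filter] at hw
    obtain ⟨u, v, i, hg, hi, huv⟩ := exists_conj_of_isProperPower hw.2
    have hn : norm (mk (List.ofFn w)) ≤ 2 * k := norm_mk_le.trans (by simp)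
    rw [Finset.mem_biUnion]
    refine ⟨(⟨u.length, by omega⟩, ⟨v.length, by omega⟩, ⟨i, by omega⟩), Finset.mem_univ _, ?_⟩
    simp only [T, Finset.mem_biUnion, Finset.mem_univ, true_and]
    refine ⟨u.get, v.get, ?_⟩
    simp only [List.ofFn_get]
    rw [if_pos (by rw [← hg]; exact huv)]
    simpa using hg
  calc _ ≤ ((Finset.univ.biUnion T).card : ℝ) := Nat.cast_le.2 (Finset.card_le_card hsub)
    _ ≤ ∑ p, ((T p).card : ℝ) := by exact_mod_cast Finset.card_biUnion_le
    _ ≤ ∑ p : Fin (2 * k + 1) × Fin (2 * k + 1) × Fin (2 * k + 1), (8 * Fintype.card α : ℝ) ^ k :=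
        Finset.sum_le_sum fun p _ => hT p
    _ = _ := by
        simp only [Finset.sum_const, Finset.card_univ, Fintype.card_prod, Fintype.card_fin,
          nsmul_eq_mul]
        push_cast
        ring

end FreeGroupWords

/-! ### Expected fixed points of a random evaluation of a word -/

section Trails

open FreeGroup

variable {ι P : Type*}

/-- The permutation attached to a letter `(i, b)`: it is `πᵢ` if `b = true` and `πᵢ⁻¹` otherwise. -/
def letterPerm (π : ι → Equiv.Perm P) (l : ι × Bool) : Equiv.Perm P :=
  cond l.2 (π l.1) (π l.1)⁻¹

/-- The inverse letter. -/
def invLetter (l : ι × Bool) : ι × Bool := (l.1, !l.2)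

theorem lift_mk_singleton (π : ι → Equiv.Perm P) (l : ι × Bool) :
    FreeGroup.lift π (mk [l]) = letterPerm π l := by
  simp [FreeGroup.lift_mk, letterPerm]

theorem letterPerm_invLetter (π : ι → Equiv.Perm P) (l : ι × Bool) :
    letterPerm π (invLetter l) = (letterPerm π l)⁻¹ := by
  obtain ⟨i, _ | _⟩ := l <;> simp [letterPerm, invLetter]

theorem mk_invLetter (l : ι × Bool) : mk [invLetter l] = (mk [l])⁻¹ := by
  simp [inv_mk, invRev, invLetter]

/-- The group element spelled by the first `s` letters of `a`, read from right to left. -/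
def trailWord (a : ℕ → ι × Bool) : ℕ → FreeGroup ι
  | 0 => 1
  | s + 1 => mk [a s] * trailWord a s

/-- The trail of the point `x` when the letters of `a` act one after the other. -/
def trail (π : ι → Equiv.Perm P) (a : ℕ → ι × Bool) (x : P) : ℕ → P
  | 0 => x
  | s + 1 => letterPerm π (a s) (trail π a x s)

theorem lift_trailWord (π : ι → Equiv.Perm P) (a : ℕ → ι × Bool) (x : P) (s : ℕ) :
    FreeGroup.lift π (trailWord a s) x = trail π a x s := by
  induction s with
  | zero => simp [trailWord, trail]
  | succ s ih => rw [trailWord, _root_.map_mul, Equiv.Perm.mul_apply, ih, lift_mk_singleton, trail]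

theorem norm_trailWord_le [DecidableEq ι] (a : ℕ → ι × Bool) (s : ℕ) :
    FreeGroup.norm (trailWord a s) ≤ s := by
  induction s with
  | zero => simp [trailWord]
  | succ s ih =>
    have h1 := norm_mul_le (mk [a s]) (trailWord a s)
    have h2 : FreeGroup.norm (mk [a s]) ≤ 1 := norm_mk_le
    rw [trailWord]
    omega

/-- The step number `s` of the trail is not forced by the previous steps. -/
def IsFreeStep (π : ι → Equiv.Perm P) (a : ℕ → ι × Bool) (x : P) (s : ℕ) : Prop :=
  ∀ r < s, ¬ (a r = a s ∧ trail π a x r = trail π a x s) ∧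
    ¬ (a r = invLetter (a s) ∧ trail π a x (r + 1) = trail π a x s)

/-- The step number `s` is free and leads to the point visited at time `t`. -/
def IsCoincidence (π : ι → Equiv.Perm P) (a : ℕ → ι × Bool) (x : P) (s t : ℕ) : Prop :=
  IsFreeStep π a x s ∧ trail π a x (s + 1) = trail π a x t

theorem IsFreeStep.congr {π π' : ι → Equiv.Perm P} {a : ℕ → ι × Bool} {x : P} {s : ℕ}
    (h : ∀ r ≤ s, trail π' a x r = trail π a x r) (hf : IsFreeStep π a x s) :
    IsFreeStep π' a x s := by
  intro r hr
  rw [h r hr.le, h s le_rfl, h (r + 1) hr]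
  exact hf r hr

theorem IsCoincidence.congr {π π' : ι → Equiv.Perm P} {a : ℕ → ι × Bool} {x : P} {s t : ℕ}
    (hts : t ≤ s) (h : ∀ r ≤ s + 1, trail π' a x r = trail π a x r)
    (hf : IsCoincidence π a x s t) : IsCoincidence π' a x s t :=
  ⟨hf.1.congr fun r hr => h r (by omega), by rw [h _ le_rfl, h t (by omega)]; exact hf.2⟩

/-- The visited vertices and edges form a graph whose loops are generated by those closed at
coincidences. One loop per coincidence step suffices: any other return time `t` to the same vertex
differs from it by a loop closed earlier. -/
theorem inv_mul_mem_of_trail_eq {π : ι → Equiv.Perm P} {a : ℕ → ι × Bool} {x : P} {m : ℕ}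
    {H : Subgroup (FreeGroup ι)}
    (hH : ∀ s < m, (∃ t ≤ s, IsCoincidence π a x s t) →
      ∃ t ≤ s, IsCoincidence π a x s t ∧ (trailWord a t)⁻¹ * trailWord a (s + 1) ∈ H) :
    ∀ i ≤ m, ∀ r ≤ i, ∀ r' ≤ i, trail π a x r = trail π a x r' →
      (trailWord a r')⁻¹ * trailWord a r ∈ H := by
  intro i
  induction i with
  | zero =>
    intro _ r hr r' hr' _
    obtain rfl : r = 0 := by omega
    obtain rfl : r' = 0 := by omega
    simp
  | succ i ih =>
    intro him
    have ih := ih (by omega)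
    have key : ∀ r' ≤ i, trail π a x (i + 1) = trail π a x r' →
        (trailWord a r')⁻¹ * trailWord a (i + 1) ∈ H := by
      intro r' hr' he
      have comp : ∀ t ≤ i, trail π a x (i + 1) = trail π a x t →
          (trailWord a t)⁻¹ * trailWord a (i + 1) ∈ H →
          (trailWord a r')⁻¹ * trailWord a (i + 1) ∈ H := by
        intro t ht het hmem
        have := H.mul_mem (ih t ht r' hr' (het.symm.trans he)) hmem
        simpa [mul_assoc] using this
      by_cases hf : IsFreeStep π a x i
      · obtain ⟨t, ht, hc, hmem⟩ := hH i (by omega) ⟨r', hr', hf, he⟩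
        exact comp t ht hc.2 hmem
      -- A forced step retraces an old edge, so its endpoint was already visited at time `r + 1` or
      -- `r`, depending on the direction. The new loop reduces to a loop between earlier times.
      · simp only [IsFreeStep, not_forall] at hf
        obtain ⟨r, hr, hf⟩ := hf
        rw [not_and_or, not_not, not_not] at hf
        rcases hf with ⟨hl, hX⟩ | ⟨hl, hX⟩
        · refine comp (r + 1) hr ?_ ?_
          · rw [trail, trail, hl, hX]
          · rw [trailWord, trailWord, hl, mul_inv_rev, mul_assoc, inv_mul_cancel_left]
            exact ih i le_rfl r hr.le hX.symm
        · refine comp r hr.le ?_ ?_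
          · rw [trail, ← hX, trail, hl, letterPerm_invLetter]
            exact (letterPerm π (a i)).apply_symm_apply _
          · have := ih i le_rfl (r + 1) hr hX.symm
            rw [trailWord, hl, mk_invLetter, mul_inv_rev, inv_inv, mul_assoc] at this
            exact this
    intro r hr r' hr' he
    rcases Nat.le_succ_iff.1 hr with hr | rfl <;> rcases Nat.le_succ_iff.1 hr' with hr' | rfl
    · exact ih r hr r' hr' he
    · have := H.inv_mem (key r hr he.symm)
      simpa using this
    · exact key r' hr' he
    · simp

/-- If only one step is a coincidence, all loops lie in a cyclic group `⟨h⟩`, so a word that is not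
a proper power equals `h` or `h⁻¹`. The length condition, expressing cyclic reducedness, excludes
`h⁻¹` and forces the loop `h` to be the whole trail. With no coincidence the word would be `1`. -/
theorem isCoincidence_of_trail_eq [DecidableEq ι] {π : ι → Equiv.Perm P} {a : ℕ → ι × Bool}
    {x : P} {m : ℕ} (hpow : ¬ IsProperPower (trailWord a m))
    (hred : ∀ t ≤ m, FreeGroup.norm (trailWord a t * trailWord a m) = t + m)
    (hx : trail π a x m = x) :
    IsCoincidence π a x (m - 1) 0 ∨ ∃ s' < m, ∃ s < s', ∃ t ≤ s, ∃ t' ≤ s',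
      IsCoincidence π a x s t ∧ IsCoincidence π a x s' t' := by
  by_contra hcon
  rw [not_or] at hcon
  obtain ⟨hlast, htwo⟩ := hcon
  have huniq : ∀ s < m, ∀ s' < m, ∀ t ≤ s, ∀ t' ≤ s', IsCoincidence π a x s t →
      IsCoincidence π a x s' t' → s = s' := by
    intro s hs s' hs' t ht t' ht' h h'
    rcases lt_trichotomy s s' with hlt | rfl | hlt
    · exact (htwo ⟨s', hs', s, hlt, t, ht, t', ht', h, h'⟩).elim
    · rfl
    · exact (htwo ⟨s, hs, s', hlt, t', ht', t, ht, h', h⟩).elim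
  have hx0 : trail π a x m = trail π a x 0 := hx
  by_cases hex : ∃ s < m, ∃ t ≤ s, IsCoincidence π a x s t
  · obtain ⟨s, hs, t, ht, hst⟩ := hex
    have hmem := inv_mul_mem_of_trail_eq (π := π) (a := a) (x := x) (m := m)
      (H := Subgroup.zpowers ((trailWord a t)⁻¹ * trailWord a (s + 1))) (by
        rintro i hi ⟨r, hr, hir⟩
        obtain rfl := huniq s hs i hi t ht r hr hst hir
        exact ⟨t, ht, hst, Subgroup.mem_zpowers _⟩) m le_rfl m le_rfl 0 (Nat.zero_le _) hx0
    simp only [trailWord, inv_one, one_mul] at hmem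
    rcases isProperPower_of_mem_zpowers hmem with h | h | h
    · exact hpow h
    · have h1 : trailWord a t * trailWord a m = trailWord a (s + 1) := by
        rw [h, mul_inv_cancel_left, trailWord]
      have h2 := hred t (by omega)
      have h3 := norm_trailWord_le a (s + 1)
      rw [h1] at h2
      obtain rfl : t = 0 := by omega
      obtain rfl : s = m - 1 := by omega
      exact hlast hst
    · have h1 : trailWord a (s + 1) * trailWord a m = trailWord a t := by
        rw [h, mul_inv_rev, inv_inv, trailWord, mul_inv_cancel_left]
      have h2 := hred (s + 1) (by omega)
      have h3 := norm_trailWord_le a t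
      rw [h1] at h2
      omega
  · have hmem := inv_mul_mem_of_trail_eq (π := π) (a := a) (x := x) (m := m) (H := ⊥)
      (by
        rintro i hi ⟨r, hr, hir⟩
        exact (hex ⟨i, hi, r, hr, hir⟩).elim) m le_rfl m le_rfl 0 (Nat.zero_le _) hx0
    rw [trailWord, inv_one, one_mul, Subgroup.mem_bot] at hmem
    exact hpow ⟨1, 0, by simp, by simpa using hmem⟩

variable [DecidableEq ι]

theorem exists_trailWord_eq {g : FreeGroup ι} (hg : ¬ IsProperPower g) :
    ∃ (u : FreeGroup ι) (a : ℕ → ι × Bool) (m : ℕ), m ≤ FreeGroup.norm g ∧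
      g = u * trailWord a m * u⁻¹ ∧ ¬ IsProperPower (trailWord a m) ∧
      ∀ t ≤ m, FreeGroup.norm (trailWord a t * trailWord a m) = t + m := by
  set u := reduceCyclically.conjugator g.toWord
  set z := reduceCyclically g.toWord
  have hu : u ++ z ++ invRev u = g.toWord := reduceCyclically.conj_conjugator_reduceCyclically _
  have hcyc : IsCyclicallyReduced z := reduceCyclically.isCyclicallyReduced isReduced_toWord
  have hgc : g = mk u * mk z * (mk u)⁻¹ := by rw [inv_mk, mul_mk, mul_mk, hu, mk_toWord]
  have hc : ¬ IsProperPower (mk z) := fun h => hg (hgc ▸ h.conj _)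
  have hne : z ≠ [] := by
    intro h
    rw [h] at hc
    exact hc ⟨1, 0, by simp, by simp [one_eq_mk]⟩
  -- Permutations compose from right to left, so the trail reads `z` from its end. The values for `s
  -- ≥ z.length` are irrelevant.
  set a : ℕ → ι × Bool := fun s => z.getD (z.length - (s + 1)) (z.head hne)
  have hword : ∀ t ≤ z.length, trailWord a t = mk (z.drop (z.length - t)) := by
    intro t
    induction t with
    | zero => intro _; simp [trailWord, one_eq_mk]
    | succ t ih =>
      intro ht
      have hlt : z.length - (t + 1) < z.length := by omega
      have ha : a t = z[z.length - (t + 1)] := List.getD_eq_getElem _ _ hlt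
      rw [trailWord, ih (by omega), mul_mk, List.drop_eq_getElem_cons hlt, ha,
        show z.length - (t + 1) + 1 = z.length - t by omega]
      rfl
  have hfull : trailWord a z.length = mk z := by simpa using hword z.length le_rfl
  refine ⟨mk u, a, z.length, ?_, by rw [hfull, ← hgc], by rwa [hfull], fun t ht => ?_⟩
  · rw [FreeGroup.norm, ← hu]
    simp
    omega
  · have hred : IsReduced (z ++ z) := by simpa using (hcyc.flatten_replicate 2).isReduced
    have hred2 : IsReduced (z.drop (z.length - t) ++ z) := by
      refine hred.infix ⟨z.take (z.length - t), [], ?_⟩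
      rw [← List.append_assoc, List.take_append_drop, List.append_nil]
    rw [hfull, hword t ht, mul_mk, FreeGroup.norm, toWord_mk, hred2.reduce_eq]
    simp
    omega

/-- Compose the permutation of one letter with `τ`, on the side of the values of the letter. -/
def twist (π : ι → Equiv.Perm P) (l : ι × Bool) (τ : Equiv.Perm P) : ι → Equiv.Perm P :=
  Function.update π l.1 (cond l.2 (τ * π l.1) (π l.1 * τ))

theorem letterPerm_twist_of_ne (π : ι → Equiv.Perm P) {l l' : ι × Bool} (τ : Equiv.Perm P)
    (h : l' ≠ l) (h' : l' ≠ invLetter l) : letterPerm (twist π l τ) l' = letterPerm π l' := by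
  have hne : l'.1 ≠ l.1 := by
    intro he
    obtain ⟨i, b⟩ := l
    obtain ⟨i', b'⟩ := l'
    cases b <;> cases b' <;> simp_all [invLetter]
  simp [letterPerm, twist, hne]

variable [DecidableEq P]

theorem twist_twist (π : ι → Equiv.Perm P) (l : ι × Bool) (b y : P) :
    twist (twist π l (Equiv.swap b y)) l (Equiv.swap b y) = π := by
  obtain ⟨i, _ | _⟩ := l <;>
    simp only [twist, Function.update_self, Function.update_idem, cond_true, cond_false]
  · rw [mul_assoc, Equiv.swap_mul_self, mul_one, Function.update_eq_self]
  · rw [← mul_assoc, Equiv.swap_mul_self, one_mul, Function.update_eq_self]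

theorem letterPerm_twist_self (π : ι → Equiv.Perm P) (l : ι × Bool) (b y : P) :
    letterPerm (twist π l (Equiv.swap b y)) l = Equiv.swap b y * letterPerm π l := by
  obtain ⟨i, _ | _⟩ := l <;> simp [twist, letterPerm]

theorem letterPerm_twist_invLetter (π : ι → Equiv.Perm P) (l : ι × Bool) (b y : P) :
    letterPerm (twist π l (Equiv.swap b y)) (invLetter l)
      = letterPerm π (invLetter l) * Equiv.swap b y := by
  rw [letterPerm_invLetter, letterPerm_twist_self, letterPerm_invLetter]; simp

/-- A set of at most `s` points that contains every known value of the letter used in step `s`. -/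
def seen (π : ι → Equiv.Perm P) (a : ℕ → ι × Bool) (x : P) (s : ℕ) : Finset P :=
  (Finset.range s).image fun r => if a r = a s then trail π a x (r + 1) else trail π a x r

theorem card_seen_le (π : ι → Equiv.Perm P) (a : ℕ → ι × Bool) (x : P) (s : ℕ) :
    (seen π a x s).card ≤ s :=
  Finset.card_image_le.trans (by simp)

/-- The swap moves only `b` and the endpoint of step `s`. Neither is a value of the letter `a s`
revealed earlier: the first since `b ∉ seen`, the second since the step is free. -/
theorem trail_twist {π : ι → Equiv.Perm P} {a : ℕ → ι × Bool} {x : P} {s : ℕ} {b : P}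
    (hf : IsFreeStep π a x s) (hb : b ∉ seen π a x s) :
    ∀ r ≤ s, trail (twist π (a s) (Equiv.swap b (trail π a x (s + 1)))) a x r
      = trail π a x r := by
  have hb' : ∀ r < s, b ≠ if a r = a s then trail π a x (r + 1) else trail π a x r := by
    intro r hr he
    exact hb (Finset.mem_image.2 ⟨r, Finset.mem_range.2 hr, he.symm⟩)
  intro r
  induction r with
  | zero => intro _; rfl
  | succ r ih =>
    intro hr
    have hr' : r < s := hr
    have hbr := hb' r hr'
    rw [trail, ih hr'.le]
    by_cases h1 : a r = a s
    · rw [h1, letterPerm_twist_self, Equiv.Perm.mul_apply, ← h1]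
      rw [if_pos h1, trail] at hbr
      refine (Equiv.swap_apply_of_ne_of_ne hbr.symm fun he => ?_).trans rfl
      rw [trail, ← h1] at he
      exact (hf r hr').1 ⟨h1, (letterPerm π (a r)).injective he⟩
    · rw [if_neg h1] at hbr
      by_cases h2 : a r = invLetter (a s)
      · rw [h2, letterPerm_twist_invLetter, Equiv.Perm.mul_apply,
          Equiv.swap_apply_of_ne_of_ne hbr.symm, ← h2]
        · rfl
        · intro he
          refine (hf r hr').2 ⟨h2, ?_⟩
          rw [trail, h2, letterPerm_invLetter, he, trail]
          exact (letterPerm π (a s)).symm_apply_apply _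
      · rw [letterPerm_twist_of_ne π _ h1 h2]
        rfl

theorem trail_twist_succ {π : ι → Equiv.Perm P} {a : ℕ → ι × Bool} {x : P} {s : ℕ} {b : P}
    (hf : IsFreeStep π a x s) (hb : b ∉ seen π a x s) :
    trail (twist π (a s) (Equiv.swap b (trail π a x (s + 1)))) a x (s + 1) = b := by
  rw [trail, trail_twist hf hb s le_rfl, letterPerm_twist_self, Equiv.Perm.mul_apply, trail,
    Equiv.swap_apply_right]

variable [Fintype ι] [Fintype P]

open Classical in
-- A switching argument in place of conditional probability: redirect the free step `s` to any of
-- the at least `|P| - s` unseen points `b`. The event `E` survives because it depends only on the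
-- trail up to time `s`.
theorem card_isCoincidence_mul_le (a : ℕ → ι × Bool) (x : P) {s t : ℕ} (hts : t ≤ s)
    (E : (ι → Equiv.Perm P) → Prop)
    (hE : ∀ π π', (∀ r ≤ s, trail π' a x r = trail π a x r) → E π → E π') :
    (Finset.univ.filter fun π => E π ∧ IsCoincidence π a x s t).card * (Fintype.card P - s)
      ≤ (Finset.univ.filter E).card := by
  set A := Finset.univ.filter fun π => E π ∧ IsCoincidence π a x s t
  calc A.card * (Fintype.card P - s)
      ≤ ∑ π ∈ A, ((seen π a x s)ᶜ).card := by
        rw [← smul_eq_mul]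
        refine Finset.card_nsmul_le_sum _ _ _ fun π _ => ?_
        rw [Finset.card_compl]
        have := card_seen_le π a x s
        omega
    _ = (A.sigma fun π => (seen π a x s)ᶜ).card := (Finset.card_sigma _ _).symm
    _ ≤ _ := by
        refine Finset.card_le_card_of_injOn
          (fun p => twist p.1 (a s) (Equiv.swap p.2 (trail p.1 a x (s + 1)))) ?_ ?_
        · rintro ⟨π, b⟩ hp
          simp only [Finset.coe_sigma, Set.mem_sigma_iff, Finset.mem_coe, A, Finset.mem_filter,
            Finset.mem_univ, true_and, Finset.mem_compl] at hp
          simp only [Finset.coe_filter, Finset.mem_univ, true_and, Set.mem_ofPred_eq]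
          exact hE π _ (trail_twist hp.1.2.1 hp.2) hp.1.1
        · rintro ⟨π, b⟩ hp ⟨ρ, c⟩ hq heq
          simp only [Finset.coe_sigma, Set.mem_sigma_iff, Finset.mem_coe, A, Finset.mem_filter,
            Finset.mem_univ, true_and, Finset.mem_compl] at hp hq
          simp only at heq
          -- The switching is reversible: `b` is the new endpoint of step `s`, and the old endpoint
          -- is the point at time `t`, which the twist leaves in place.
          have hbc : b = c := by
            rw [← trail_twist_succ hp.1.2.1 hp.2, ← trail_twist_succ hq.1.2.1 hq.2, heq]
          have hy : trail π a x (s + 1) = trail ρ a x (s + 1) := by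
            rw [hp.1.2.2, hq.1.2.2, ← trail_twist hp.1.2.1 hp.2 t hts,
              ← trail_twist hq.1.2.1 hq.2 t hts, heq]
          have hπ : π = ρ := by
            rw [← twist_twist π (a s) b (trail π a x (s + 1)), heq, hbc, hy, twist_twist]
          subst hπ hbc
          rfl

open Classical in
theorem card_isCoincidence_le (a : ℕ → ι × Bool) (x : P) {s t m : ℕ} (hts : t ≤ s) (hs : s ≤ m)
    (hm : m < Fintype.card P) :
    ((Finset.univ.filter fun π => IsCoincidence π a x s t).card : ℝ)
      ≤ Fintype.card (ι → Equiv.Perm P) / (Fintype.card P - m : ℝ) := by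
  have hpos : (0 : ℝ) < Fintype.card P - m := by
    have : (m : ℝ) < Fintype.card P := by exact_mod_cast hm
    linarith
  have h := card_isCoincidence_mul_le a x hts (fun _ : ι → Equiv.Perm P => True) (by simp)
  simp only [true_and, Finset.filter_true, Finset.card_univ] at h
  rw [le_div_iff₀ hpos, ← Nat.cast_sub hm.le]
  exact_mod_cast (Nat.mul_le_mul_left _ (by omega)).trans h

open Classical in
theorem card_two_isCoincidence_le (a : ℕ → ι × Bool) (x : P) {s t s' t' m : ℕ} (hts : t ≤ s)
    (hss : s < s') (hts' : t' ≤ s') (hs : s' ≤ m) (hm : m < Fintype.card P) :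
    ((Finset.univ.filter fun π => IsCoincidence π a x s t ∧ IsCoincidence π a x s' t').card : ℝ)
      ≤ Fintype.card (ι → Equiv.Perm P) / (Fintype.card P - m : ℝ) ^ 2 := by
  have hpos : (0 : ℝ) < Fintype.card P - m := by
    have : (m : ℝ) < Fintype.card P := by exact_mod_cast hm
    linarith
  have h := card_isCoincidence_mul_le a x hts' (fun π => IsCoincidence π a x s t)
    (fun π π' hr hc => hc.congr hts fun r hr' => hr r (by omega))
  have h2 := card_isCoincidence_le (ι := ι) a x hts (hss.le.trans hs) hm
  rw [pow_two, ← div_div, le_div_iff₀ hpos]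
  refine le_trans ?_ h2
  rw [← Nat.cast_sub hm.le]
  exact_mod_cast (Nat.mul_le_mul_left _ (by omega)).trans h

open Classical in
theorem card_trail_eq_le {a : ℕ → ι × Bool} (x : P) {m : ℕ}
    (hpow : ¬ IsProperPower (trailWord a m))
    (hred : ∀ t ≤ m, FreeGroup.norm (trailWord a t * trailWord a m) = t + m)
    (hm : m < Fintype.card P) :
    ((Finset.univ.filter fun π : ι → Equiv.Perm P => trail π a x m = x).card : ℝ)
      ≤ Fintype.card (ι → Equiv.Perm P) / (Fintype.card P - m : ℝ)
        + m ^ 4 * (Fintype.card (ι → Equiv.Perm P) / (Fintype.card P - m : ℝ) ^ 2) := by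
  set I := (Finset.univ : Finset (Fin m × Fin m × Fin m × Fin m)).filter
    fun p => p.2.1 < p.1 ∧ p.2.2.1 ≤ p.2.1 ∧ p.2.2.2 ≤ p.1
  have hsub : (Finset.univ.filter fun π : ι → Equiv.Perm P => trail π a x m = x) ⊆
      (Finset.univ.filter fun π => IsCoincidence π a x (m - 1) 0) ∪
      I.biUnion fun p => Finset.univ.filter fun π =>
        IsCoincidence π a x p.2.1 p.2.2.1 ∧ IsCoincidence π a x p.1 p.2.2.2 := by
    intro π hπ
    rw [Finset.mem_filter] at hπ
    rw [Finset.mem_union, Finset.mem_biUnion]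
    rcases isCoincidence_of_trail_eq hpow hred hπ.2 with h | ⟨s', hs', s, hs, t, ht, t', ht', h⟩
    · exact Or.inl (by simpa using h)
    · refine Or.inr ⟨(⟨s', hs'⟩, ⟨s, by omega⟩, ⟨t, by omega⟩, ⟨t', by omega⟩), ?_, ?_⟩
      · simp only [I, Finset.mem_filter, Finset.mem_univ, true_and]
        exact ⟨hs, ht, ht'⟩
      · simpa using h
  refine (Nat.cast_le.2 ((Finset.card_le_card hsub).trans (Finset.card_union_le _ _))).trans ?_
  push_cast
  refine add_le_add (card_isCoincidence_le a x (Nat.zero_le _) (by omega) hm) ?_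
  refine (Nat.cast_le.2 Finset.card_biUnion_le).trans ?_
  push_cast
  have hB : (0 : ℝ) ≤ Fintype.card (ι → Equiv.Perm P) / (Fintype.card P - m : ℝ) ^ 2 := by
    positivity
  have hI : (I.card : ℝ) ≤ m ^ 4 := by
    refine (Nat.cast_le.2 (Finset.card_filter_le _ _)).trans ?_
    simp only [Finset.card_univ, Fintype.card_prod, Fintype.card_fin]
    push_cast
    exact le_of_eq (by ring)
  calc _ ≤ ∑ p ∈ I, (Fintype.card (ι → Equiv.Perm P) / (Fintype.card P - m : ℝ) ^ 2 : ℝ) := by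
        refine Finset.sum_le_sum fun p hp => ?_
        simp only [I, Finset.mem_filter, Finset.mem_univ, true_and] at hp
        exact card_two_isCoincidence_le a x hp.2.1 hp.1 hp.2.2 p.1.2.le hm
    _ ≤ _ := by
        rw [Finset.sum_const, nsmul_eq_mul]
        exact mul_le_mul_of_nonneg_right hI hB

/-- The number of fixed points of a permutation. -/
def fixCount {Q : Type*} [Fintype Q] [DecidableEq Q] (τ : Equiv.Perm Q) : ℕ :=
  (Finset.univ.filter fun x => τ x = x).card

theorem fixCount_conj (τ ρ : Equiv.Perm P) : fixCount (τ * ρ * τ⁻¹) = fixCount ρ := by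
  refine Finset.card_equiv τ⁻¹ fun x => ?_
  rw [Finset.mem_filter_univ, Finset.mem_filter_univ, Equiv.Perm.mul_apply, Equiv.Perm.mul_apply,
    Equiv.Perm.eq_inv_iff_eq]

/-- Conjugation preserves fixed points, so `g` may be taken cyclically reduced. Summing the trail
bound over starting points gives `n/(n-m) + m^4 n/(n-m)^2`, and `2L ≤ n` keeps `n - m ≥ n/2`. -/
theorem sum_fixCount_le {g : FreeGroup ι} (hg : ¬ IsProperPower g) {L : ℕ} (hL : 1 ≤ L)
    (hgL : FreeGroup.norm g ≤ L) (hP : 2 * L ≤ Fintype.card P) :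
    (∑ π : ι → Equiv.Perm P, (fixCount (FreeGroup.lift π g) : ℝ))
      ≤ Fintype.card (ι → Equiv.Perm P) * (1 + 6 * L ^ 4 / Fintype.card P) := by
  obtain ⟨u, a, m, hm, hgu, hpow, hred⟩ := exists_trailWord_eq hg
  have hmL : m ≤ L := hm.trans hgL
  have h1 : ∀ π : ι → Equiv.Perm P, fixCount (FreeGroup.lift π g)
      = ∑ x : P, if trail π a x m = x then 1 else 0 := by
    intro π
    rw [hgu, _root_.map_mul, _root_.map_mul, _root_.map_inv, fixCount_conj, fixCount,
      Finset.card_filter]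
    simp only [lift_trailWord]
  have h2 : (∑ π : ι → Equiv.Perm P, (fixCount (FreeGroup.lift π g) : ℝ))
      = ∑ x : P, ((Finset.univ.filter fun π : ι → Equiv.Perm P => trail π a x m = x).card : ℝ) := by
    simp only [h1, Finset.card_filter]
    push_cast
    exact Finset.sum_comm
  have h3 := Finset.sum_le_sum fun (x : P) (_ : x ∈ Finset.univ) =>
    card_trail_eq_le x hpow hred (by omega : m < Fintype.card P)
  rw [h2]
  refine le_trans (by convert h3) ?_
  rw [Finset.sum_const, Finset.card_univ, nsmul_eq_mul]
  set n : ℝ := (Fintype.card P : ℝ)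
  set N : ℝ := (Fintype.card (ι → Equiv.Perm P) : ℝ)
  have hN : 0 ≤ N := Nat.cast_nonneg _
  have hmL' : (m : ℝ) ≤ L := by exact_mod_cast hmL
  have hL' : (1 : ℝ) ≤ L := by exact_mod_cast hL
  have hPn : 2 * (L : ℝ) ≤ n := by simp only [n]; exact_mod_cast hP
  have hn : 0 < n := by linarith
  have hnm : n / 2 ≤ n - m := by linarith
  have hnm0 : 0 < n - m := by linarith
  have e1 : n * (N / (n - m)) ≤ N * (1 + 2 * L / n) := by
    rw [mul_div_assoc', div_le_iff₀ hnm0, mul_assoc, mul_comm n N]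
    refine mul_le_mul_of_nonneg_left ?_ hN
    have : (1 + 2 * L / n) * (n - m) = n - m + 2 * L * ((n - m) / n) := by
      field_simp
    rw [this]
    have : 1 / 2 ≤ (n - m) / n := by rw [le_div_iff₀ hn]; linarith
    nlinarith
  have e2 : n * (m ^ 4 * (N / (n - m) ^ 2)) ≤ N * (4 * L ^ 4 / n) := by
    have h4 : (m : ℝ) ^ 4 ≤ L ^ 4 := by gcongr
    have h5 : N / (n - m) ^ 2 ≤ N / (n / 2) ^ 2 := by gcongr
    calc n * (m ^ 4 * (N / (n - m) ^ 2)) ≤ n * (L ^ 4 * (N / (n / 2) ^ 2)) := by gcongr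
      _ = _ := by field_simp; ring
  have e3 : (L : ℝ) / n ≤ L ^ 4 / n := by
    gcongr
    exact le_self_pow₀ hL' (by norm_num)
  have e4 : N * (2 * L / n) ≤ N * (2 * L ^ 4 / n) := by
    rw [mul_div_assoc, mul_div_assoc]
    gcongr
  calc n * (N / (n - m) + m ^ 4 * (N / (n - m) ^ 2))
      = n * (N / (n - m)) + n * (m ^ 4 * (N / (n - m) ^ 2)) := by ring
    _ ≤ N * (1 + 2 * L / n) + N * (4 * L ^ 4 / n) := add_le_add e1 e2
    _ ≤ N + N * (2 * L ^ 4 / n) + N * (4 * L ^ 4 / n) := by linarith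
    _ = _ := by ring

end Trails

/-! ### Spectra under intertwining maps, power sums, and Gershgorin -/

section LinearAlgebra

/-- The algebraic multiplicity is the dimension of the maximal generalized eigenspace, and `j`
embeds that of `f` into that of `g`. -/
theorem rootMultiplicity_charpoly_le_of_intertwine {K V W : Type*} [Field K] [AddCommGroup V]
    [Module K V] [FiniteDimensional K V] [AddCommGroup W] [Module K W] [FiniteDimensional K W]
    {f : Module.End K V} {g : Module.End K W} {j : V →ₗ[K] W} (hj : Function.Injective j)
    (h : g ∘ₗ j = j ∘ₗ f) (c : K) :
    f.charpoly.rootMultiplicity c ≤ g.charpoly.rootMultiplicity c := by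
  rw [← LinearMap.finrank_maxGenEigenspace_eq, ← LinearMap.finrank_maxGenEigenspace_eq,
    (Submodule.equivMapOfInjective j hj _).finrank_eq]
  refine Submodule.finrank_mono ?_
  rintro _ ⟨v, hv, rfl⟩
  obtain ⟨k, hk⟩ := Module.End.mem_maxGenEigenspace _ _ _ |>.1 hv
  refine Module.End.mem_maxGenEigenspace _ _ _ |>.2 ⟨k, ?_⟩
  have hcomm : ∀ (k : ℕ) (v : V), ((g - c • (1 : Module.End K W)) ^ k) (j v)
      = j (((f - c • (1 : Module.End K V)) ^ k) v) := by
    intro k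
    induction k with
    | zero => intro v; simp
    | succ k ih =>
      intro v
      have h1 := LinearMap.congr_fun h v
      simp only [LinearMap.comp_apply] at h1
      rw [pow_succ, pow_succ, Module.End.mul_apply, Module.End.mul_apply, ← ih]
      simp [h1]
  rw [hcomm, hk, map_zero]

theorem roots_charpoly_le_of_intertwine {m n : Type*} [Fintype m] [DecidableEq m] [Fintype n]
    [DecidableEq n] {A : Matrix m m ℝ} {B : Matrix n n ℝ} {j : (n → ℝ) →ₗ[ℝ] (m → ℝ)}
    (hj : Function.Injective j) (h : ∀ v, A.mulVec (j v) = j (B.mulVec v)) :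
    B.charpoly.roots ≤ A.charpoly.roots := by
  refine Multiset.le_iff_count.2 fun c => ?_
  rw [Polynomial.count_roots, Polynomial.count_roots, ← Matrix.charpoly_toLin',
    ← Matrix.charpoly_toLin']
  exact rootMultiplicity_charpoly_le_of_intertwine hj (LinearMap.ext fun v => by simp [h]) c

theorem sum_pow_roots_charpoly {n : Type*} [Fintype n] [DecidableEq n] {A : Matrix n n ℝ}
    (hA : A.IsHermitian) (L : ℕ) :
    (A.charpoly.roots.map fun x => x ^ L).sum = (A ^ L).trace := by
  rw [hA.roots_charpoly_eq_eigenvalues]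
  conv_rhs => rw [hA.spectral_theorem, ← map_pow, Matrix.diagonal_pow,
    Unitary.conjStarAlgAut_apply, Matrix.trace_mul_comm, ← mul_assoc]
  simp [Matrix.trace_diagonal]

theorem abs_le_of_mem_roots_charpoly {n : Type*} [Fintype n] [DecidableEq n] {A : Matrix n n ℝ}
    {B : ℝ} (hA : ∀ i, ∑ j, |A i j| ≤ B) {x : ℝ} (hx : x ∈ A.charpoly.roots) : |x| ≤ B := by
  have hroot := Polynomial.isRoot_of_mem_roots hx
  rw [← Matrix.charpoly_toLin', ← Module.End.hasEigenvalue_iff_isRoot_charpoly] at hroot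
  obtain ⟨i, hi⟩ := eigenvalue_mem_ball hroot
  rw [mem_closedBall_iff_norm, Real.norm_eq_abs] at hi
  have h1 := hA i
  rw [← Finset.add_sum_erase _ _ (Finset.mem_univ i)] at h1
  simp only [Real.norm_eq_abs] at hi
  have h2 : |x| ≤ |x - A i i| + |A i i| := by
    simpa using abs_add_le (x - A i i) (A i i)
  linarith

end LinearAlgebra

/-! ### From new eigenvalues to fixed points of words -/

section Adjacency

open FreeGroup

variable {V : Type*} [Fintype V] [DecidableEq V] {d : ℕ}

theorem adjacencyMatrix_eq_sum_letters (σ : Fin d → Equiv.Perm V) :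
    adjacencyMatrix (permGraph σ) = ∑ l : Fin d × Bool, (letterPerm σ l).permMatrix ℝ := by
  rw [adjacencyMatrix_permGraph, Fintype.sum_prod_type]
  simp [letterPerm]

theorem adjacencyMatrix_permGraph_pow (σ : Fin d → Equiv.Perm V) (L : ℕ) :
    adjacencyMatrix (permGraph σ) ^ L = ∑ w : Fin L → Fin d × Bool,
      (FreeGroup.lift σ (mk (List.ofFn w))).permMatrix ℝ := by
  induction L with
  | zero => simp [← one_eq_mk]
  | succ L ih =>
    rw [pow_succ, ih, adjacencyMatrix_eq_sum_letters, Finset.sum_mul_sum, Finset.sum_comm,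
      ← Fintype.sum_prod_type', ← (Fin.consEquiv fun _ : Fin (L + 1) => Fin d × Bool).sum_comp]
    refine Fintype.sum_congr _ _ fun p => ?_
    have h : mk (List.ofFn ((Fin.consEquiv fun _ : Fin (L + 1) => Fin d × Bool) p))
        = mk [p.1] * mk (List.ofFn p.2) := by
      rw [mul_mk]; simp [Fin.consEquiv, List.ofFn_succ]
    rw [h, _root_.map_mul, Matrix.permMatrix_mul, lift_mk_singleton]

theorem trace_adjacencyMatrix_permGraph_pow (σ : Fin d → Equiv.Perm V) (L : ℕ) :
    (adjacencyMatrix (permGraph σ) ^ L).trace = ∑ w : Fin L → Fin d × Bool,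
      (fixCount (FreeGroup.lift σ (mk (List.ofFn w))) : ℝ) := by
  rw [adjacencyMatrix_permGraph_pow, Matrix.trace_sum]
  refine Fintype.sum_congr _ _ fun w => ?_
  rw [Matrix.trace_permutation, fixCount, ← Set.ncard_coe_finset]
  congr 2
  ext x
  simp [Function.IsFixedPt, Function.mem_fixedPoints]

theorem isHermitian_adjacencyMatrix_permGraph (σ : Fin d → Equiv.Perm V) :
    (adjacencyMatrix (permGraph σ)).IsHermitian := by
  rw [adjacencyMatrix_permGraph, Matrix.IsHermitian, Matrix.conjTranspose_sum]
  refine Finset.sum_congr rfl fun i _ => ?_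
  rw [Matrix.conjTranspose_add, Matrix.conjTranspose_permMatrix, Matrix.conjTranspose_permMatrix,
    inv_inv, add_comm]

theorem adjacencyMatrix_permGraph_mulVec (σ : Fin d → Equiv.Perm V) (v : V → ℝ) (x : V) :
    (adjacencyMatrix (permGraph σ)).mulVec v x = ∑ i, (v (σ i x) + v ((σ i)⁻¹ x)) := by
  rw [adjacencyMatrix_permGraph, Matrix.sum_mulVec, Finset.sum_apply]
  refine Finset.sum_congr rfl fun i _ => ?_
  rw [Matrix.add_mulVec, Matrix.permMatrix_mulVec, Matrix.permMatrix_mulVec]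
  rfl

theorem sum_abs_adjacencyMatrix_permGraph (σ : Fin d → Equiv.Perm V) (x : V) :
    ∑ y, |adjacencyMatrix (permGraph σ) x y| = 2 * d := by
  have h : ∀ y, |adjacencyMatrix (permGraph σ) x y| = adjacencyMatrix (permGraph σ) x y := by
    intro y
    refine abs_of_nonneg ?_
    rw [adjacencyMatrix, Matrix.of_apply]
    split_ifs <;> positivity
  have h1 := adjacencyMatrix_permGraph_mulVec σ (fun _ => 1) x
  simp only [Matrix.mulVec, dotProduct, mul_one, Finset.sum_const, Finset.card_univ,
    Fintype.card_fin, nsmul_eq_mul] at h1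
  rw [Fintype.sum_congr _ _ h, h1]
  ring

/-- Pulling functions back along `V × [n] → V` intertwines the adjacency matrices. This makes the
multiset difference defining the new eigenvalues a genuine, untruncated one. -/
theorem spectrum_permGraph_le_productGraph {n : ℕ} (hn : 0 < n) (σ : Fin d → Equiv.Perm V)
    (π : Fin d → Equiv.Perm (Fin n)) :
    spectrum (permGraph σ) ≤ spectrum (productGraph σ π) := by
  refine roots_charpoly_le_of_intertwine (j := LinearMap.funLeft ℝ ℝ Prod.fst)
    (LinearMap.funLeft_injective_of_surjective _ _ _ ?_) fun v => ?_
  · exact fun x => ⟨(x, ⟨0, hn⟩), rfl⟩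
  · ext p
    rw [productGraph, adjacencyMatrix_permGraph_mulVec, LinearMap.funLeft_apply,
      adjacencyMatrix_permGraph_mulVec]
    rfl

theorem lift_prodCongr {Q P : Type*} (σ : Fin d → Equiv.Perm Q) (π : Fin d → Equiv.Perm P)
    (g : FreeGroup (Fin d)) :
    FreeGroup.lift (fun i => (σ i).prodCongr (π i)) g
      = (FreeGroup.lift σ g).prodCongr (FreeGroup.lift π g) := by
  induction g using FreeGroup.induction_on with
  | C1 => simp; rfl
  | of i => simp
  | inv_of i _ => simp; rfl
  | mul x y hx hy => rw [_root_.map_mul, hx, hy, _root_.map_mul, _root_.map_mul]; rfl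

theorem fixCount_prodCongr {P : Type*} [Fintype P] [DecidableEq P] (τ : Equiv.Perm V)
    (ρ : Equiv.Perm P) : fixCount (τ.prodCongr ρ) = fixCount τ * fixCount ρ := by
  rw [fixCount, fixCount, fixCount, ← Finset.card_product]
  congr 1
  ext ⟨x, y⟩
  simp

theorem fold_max_eq_zero_or_mem (s : Multiset ℝ) : s.fold max 0 = 0 ∨ s.fold max 0 ∈ s := by
  induction s using Multiset.induction_on with
  | empty => simp
  | cons a s ih =>
    rw [Multiset.fold_cons_left]
    rcases max_choice a (s.fold max 0) with h | h
    · rw [h]; simp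
    · rw [h]
      exact ih.imp id (Multiset.mem_cons_of_mem)

theorem muProduct_eq_zero_or_abs {n : ℕ} (σ : Fin d → Equiv.Perm V)
    (π : Fin d → Equiv.Perm (Fin n)) : muProduct σ π = 0 ∨
      ∃ x ∈ spectrum (productGraph σ π) - spectrum (permGraph σ), muProduct σ π = |x| := by
  refine (fold_max_eq_zero_or_mem _).imp id fun h => ?_
  obtain ⟨x, hx, he⟩ := Multiset.mem_map.1 h
  exact ⟨x, hx, he.symm⟩

theorem muProduct_nonneg {n : ℕ} (σ : Fin d → Equiv.Perm V)
    (π : Fin d → Equiv.Perm (Fin n)) : 0 ≤ muProduct σ π := by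
  rcases muProduct_eq_zero_or_abs σ π with h | ⟨x, -, h⟩ <;> rw [h]
  exact abs_nonneg x

/-- Gershgorin, with all absolute row sums equal to `2d`. -/
theorem muProduct_le {n : ℕ} (σ : Fin d → Equiv.Perm V) (π : Fin d → Equiv.Perm (Fin n)) :
    muProduct σ π ≤ 2 * d := by
  rcases muProduct_eq_zero_or_abs σ π with h | ⟨x, hx, h⟩ <;> rw [h]
  · positivity
  · exact abs_le_of_mem_roots_charpoly (fun p => (sum_abs_adjacencyMatrix_permGraph _ p).le)
      (Multiset.mem_of_le tsub_le_self hx)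

theorem muProduct_pow_le {n : ℕ} (hn : 0 < n) (σ : Fin d → Equiv.Perm V)
    (π : Fin d → Equiv.Perm (Fin n)) {k : ℕ} (hk : k ≠ 0) :
    muProduct σ π ^ (2 * k) ≤ ∑ w : Fin (2 * k) → Fin d × Bool,
      (fixCount (FreeGroup.lift σ (mk (List.ofFn w))) : ℝ) *
        (fixCount (FreeGroup.lift π (mk (List.ofFn w))) - 1) := by
  have hsum : ((spectrum (productGraph σ π) - spectrum (permGraph σ)).map
      fun x => x ^ (2 * k)).sum = ∑ w : Fin (2 * k) → Fin d × Bool,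
      (fixCount (FreeGroup.lift σ (mk (List.ofFn w))) : ℝ) *
        (fixCount (FreeGroup.lift π (mk (List.ofFn w))) - 1) := by
    have h1 := congrArg (fun s => (Multiset.map (fun x : ℝ => x ^ (2 * k)) s).sum)
      (tsub_add_cancel_of_le (spectrum_permGraph_le_productGraph hn σ π))
    simp only [Multiset.map_add, Multiset.sum_add] at h1
    have h2 : ((spectrum (productGraph σ π)).map fun x => x ^ (2 * k)).sum = _ :=
      sum_pow_roots_charpoly (isHermitian_adjacencyMatrix_permGraph _) (2 * k)
    have h3 : ((spectrum (permGraph σ)).map fun x => x ^ (2 * k)).sum = _ :=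
      sum_pow_roots_charpoly (isHermitian_adjacencyMatrix_permGraph σ) (2 * k)
    rw [trace_adjacencyMatrix_permGraph_pow] at h2 h3
    rw [eq_sub_of_add_eq h1, h2, h3, ← Finset.sum_sub_distrib]
    refine Fintype.sum_congr _ _ fun w => ?_
    rw [lift_prodCongr, fixCount_prodCongr]
    push_cast
    ring
  have hnn : ∀ y ∈ (spectrum (productGraph σ π) - spectrum (permGraph σ)).map
      (fun x : ℝ => x ^ (2 * k)), 0 ≤ y := by
    intro y hy
    obtain ⟨x, -, rfl⟩ := Multiset.mem_map.1 hy
    exact (even_two_mul k).pow_nonneg x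
  rw [← hsum]
  rcases muProduct_eq_zero_or_abs σ π with h | ⟨x, hx, h⟩ <;> rw [h]
  · rw [zero_pow (by omega)]
    exact Multiset.sum_nonneg hnn
  · rw [(even_two_mul k).pow_abs]
    exact Multiset.single_le_sum hnn _ (Multiset.mem_map_of_mem _ hx)

theorem fixCount_le (τ : Equiv.Perm V) : fixCount τ ≤ Fintype.card V :=
  Finset.card_filter_le _ _

theorem sum_fixCount_sub_one_le {n k : ℕ} (hk : k ≠ 0) (hkn : 4 * k ≤ n)
    {g : FreeGroup (Fin d)} (hg : FreeGroup.norm g ≤ 2 * k) (hpow : ¬ IsProperPower g) :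
    ∑ π : Fin d → Equiv.Perm (Fin n), ((fixCount (FreeGroup.lift π g) : ℝ) - 1)
      ≤ Fintype.card (Fin d → Equiv.Perm (Fin n)) * (96 * k ^ 4 / n) := by
  have h := sum_fixCount_le (P := Fin n) hpow (L := 2 * k) (by omega) hg
    (by rw [Fintype.card_fin]; omega)
  rw [Fintype.card_fin n] at h
  rw [Finset.sum_sub_distrib, Finset.sum_const, Finset.card_univ, nsmul_one]
  push_cast at h
  have e : 6 * (2 * (k : ℝ)) ^ 4 / n = 96 * k ^ 4 / n := by ring
  rw [e] at h
  linarith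

open Classical in
theorem sum_muProduct_pow_le {n k : ℕ} (hd : 0 < d) (hk : k ≠ 0) (hkn : 4 * k ≤ n)
    (σ : Fin d → Equiv.Perm V) :
    ∑ π : Fin d → Equiv.Perm (Fin n), muProduct σ π ^ (2 * k)
      ≤ Fintype.card (Fin d → Equiv.Perm (Fin n)) * (Fintype.card V *
        ((2 * k + 1) ^ 3 * (8 * d) ^ k * n + (2 * d) ^ (2 * k) * (96 * k ^ 4 / n))) := by
  have : Nonempty (Fin d) := ⟨⟨0, hd⟩⟩
  set N : ℝ := (Fintype.card (Fin d → Equiv.Perm (Fin n)) : ℝ) with hN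
  set M : ℝ := (Fintype.card V : ℝ) with hM
  have hN0 : 0 ≤ N := Nat.cast_nonneg _
  have hM0 : 0 ≤ M := Nat.cast_nonneg _
  have hterm : ∀ w : Fin (2 * k) → Fin d × Bool,
      ∑ π : Fin d → Equiv.Perm (Fin n),
        (fixCount (FreeGroup.lift σ (mk (List.ofFn w))) : ℝ) *
          (fixCount (FreeGroup.lift π (mk (List.ofFn w))) - 1)
      ≤ N * M * ((if IsProperPower (mk (List.ofFn w)) then (n : ℝ) else 0) + 96 * k ^ 4 / n) := by
    intro w
    have hB : ∑ π : Fin d → Equiv.Perm (Fin n),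
        ((fixCount (FreeGroup.lift π (mk (List.ofFn w))) : ℝ) - 1)
        ≤ N * ((if IsProperPower (mk (List.ofFn w)) then (n : ℝ) else 0) + 96 * k ^ 4 / n) := by
      split_ifs with hp
      · have h1 : ∀ π : Fin d → Equiv.Perm (Fin n),
            ((fixCount (FreeGroup.lift π (mk (List.ofFn w))) : ℝ) - 1) ≤ n := by
          intro π
          have h2 : (fixCount (FreeGroup.lift π (mk (List.ofFn w))) : ℝ) ≤ n := by
            have := fixCount_le (FreeGroup.lift π (mk (List.ofFn w)))
            rw [Fintype.card_fin] at this
            exact_mod_cast this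
          linarith
        refine (Finset.sum_le_sum fun π _ => h1 π).trans ?_
        rw [Finset.sum_const, Finset.card_univ, nsmul_eq_mul, ← hN]
        refine mul_le_mul_of_nonneg_left ?_ hN0
        have : (0 : ℝ) ≤ 96 * k ^ 4 / n := by positivity
        linarith
      · rw [zero_add]
        exact sum_fixCount_sub_one_le hk hkn (norm_mk_le.trans (by simp)) hp
    have hF : (fixCount (FreeGroup.lift σ (mk (List.ofFn w))) : ℝ) ≤ M :=
      Nat.cast_le.2 (fixCount_le _)
    have hB0 : 0 ≤ N * ((if IsProperPower (mk (List.ofFn w)) then (n : ℝ) else 0)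
        + 96 * k ^ 4 / n) := by
      have : (0 : ℝ) ≤ if IsProperPower (mk (List.ofFn w)) then (n : ℝ) else 0 := by
        split_ifs <;> positivity
      positivity
    rw [← Finset.mul_sum]
    calc _ ≤ _ := mul_le_mul_of_nonneg_left hB (Nat.cast_nonneg _)
      _ ≤ _ := mul_le_mul_of_nonneg_right hF hB0
      _ = _ := by ring
  calc ∑ π : Fin d → Equiv.Perm (Fin n), muProduct σ π ^ (2 * k)
      ≤ ∑ π : Fin d → Equiv.Perm (Fin n), ∑ w : Fin (2 * k) → Fin d × Bool,
        (fixCount (FreeGroup.lift σ (mk (List.ofFn w))) : ℝ) *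
          (fixCount (FreeGroup.lift π (mk (List.ofFn w))) - 1) :=
        Finset.sum_le_sum fun π _ => muProduct_pow_le (by omega) σ π hk
    _ ≤ ∑ w : Fin (2 * k) → Fin d × Bool,
        N * M * ((if IsProperPower (mk (List.ofFn w)) then (n : ℝ) else 0) + 96 * k ^ 4 / n) := by
        rw [Finset.sum_comm]
        exact Finset.sum_le_sum fun w _ => hterm w
    _ = N * (M * (((Finset.univ.filter fun w : Fin (2 * k) → Fin d × Bool =>
          IsProperPower (mk (List.ofFn w))).card : ℝ) * n
          + (2 * d) ^ (2 * k) * (96 * k ^ 4 / n))) := by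
        rw [← Finset.mul_sum, Finset.sum_add_distrib, ← Finset.sum_filter, Finset.sum_const,
          Finset.sum_const, Finset.card_univ]
        simp only [Fintype.card_fun, Fintype.card_prod, Fintype.card_fin, Fintype.card_bool,
          nsmul_eq_mul]
        push_cast
        ring
    _ ≤ _ := by
        have h := card_isProperPower_words_le (α := Fin d) k
        rw [Fintype.card_fin] at h
        gcongr

end Adjacency

/-! ### Choice of the word length and passage to the limit -/

section Asymptotics

theorem eventually_mul_pow_lt_pow (b : ℝ) (e : ℕ) {r : ℝ} (hr : 1 < r) :
    ∀ᶠ k : ℕ in atTop, b * (k : ℝ) ^ e < r ^ k := by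
  have h := (tendsto_pow_const_div_const_pow_of_one_lt e hr).const_mul b
  rw [mul_zero] at h
  filter_upwards [h.eventually_lt_const one_pos] with k hk
  rwa [← mul_div_assoc, div_lt_one (by positivity)] at hk

variable {V : Type*} [Fintype V] [DecidableEq V] {d : ℕ}

theorem card_perms_pos (d n : ℕ) : (0 : ℝ) < Fintype.card (Fin d → Equiv.Perm (Fin n)) :=
  Nat.cast_pos.2 Fintype.card_pos

theorem expectation_pow_le {n : ℕ} (m : ℕ) {f : (Fin d → Equiv.Perm (Fin n)) → ℝ}
    (hf : ∀ π, 0 ≤ f π) : expectation f ^ m ≤ expectation fun π => f π ^ m := by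
  have hN := card_perms_pos d n
  have h := Real.pow_arith_mean_le_arith_mean_pow Finset.univ
    (fun _ => (Fintype.card (Fin d → Equiv.Perm (Fin n)) : ℝ)⁻¹) f
    (fun _ _ => by positivity) (by simp) (fun π _ => hf π) m
  rw [← Finset.mul_sum, ← Finset.mul_sum] at h
  simpa only [expectation, div_eq_inv_mul] using h

theorem expectation_le_of_le {n : ℕ} {f : (Fin d → Equiv.Perm (Fin n)) → ℝ} {B : ℝ}
    (hf : ∀ π, f π ≤ B) : expectation f ≤ B := by
  rw [expectation, div_le_iff₀ (card_perms_pos d n), mul_comm]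
  simpa using Finset.sum_le_sum fun π (_ : π ∈ Finset.univ) => hf π

theorem probability_le_one {n : ℕ} (p : (Fin d → Equiv.Perm (Fin n)) → Prop) :
    probability p ≤ 1 := by
  rw [probability, div_le_one (card_perms_pos d n), ← Nat.card_eq_fintype_card]
  exact Nat.cast_le.2 (Finite.card_subtype_le p)

theorem probability_eq_one {n : ℕ} {p : (Fin d → Equiv.Perm (Fin n)) → Prop} (hp : ∀ π, p π) :
    probability p = 1 := by
  classical
  rw [probability, div_eq_one_iff_eq (card_perms_pos d n).ne', Nat.card_eq_fintype_card,
    Fintype.card_subtype, Finset.filter_true_of_mem fun π _ => hp π, Finset.card_univ]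

theorem one_sub_probability_mul_le {n : ℕ} (m : ℕ) {f : (Fin d → Equiv.Perm (Fin n)) → ℝ}
    (hf : ∀ π, 0 ≤ f π) {B : ℝ} (hB : 0 ≤ B) :
    (1 - probability fun π => f π ≤ B) * B ^ m ≤ expectation fun π => f π ^ m := by
  classical
  have hN := card_perms_pos d n
  have hcard : (Nat.card {π // f π ≤ B} : ℝ) + (Finset.univ.filter fun π => ¬ f π ≤ B).card
      = Fintype.card (Fin d → Equiv.Perm (Fin n)) := by
    rw [Nat.card_eq_fintype_card, Fintype.card_subtype]
    exact_mod_cast Finset.card_filter_add_card_filter_not _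
  have h1 : 1 - probability (fun π => f π ≤ B) =
      (Finset.univ.filter fun π => ¬ f π ≤ B).card / Fintype.card (Fin d → Equiv.Perm (Fin n)) := by
    rw [probability, eq_div_iff hN.ne', sub_mul, div_mul_cancel₀ _ hN.ne']
    linarith
  rw [h1, expectation, div_mul_eq_mul_div]
  refine div_le_div_of_nonneg_right ?_ hN.le
  rw [← nsmul_eq_mul, ← Finset.sum_const]
  refine (Finset.sum_le_sum fun π hπ => ?_).trans
    (Finset.sum_le_sum_of_subset_of_nonneg (Finset.subset_univ _)
      fun π _ _ => pow_nonneg (hf π) m)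
  rw [Finset.mem_filter, not_le] at hπ
  exact pow_le_pow_left₀ hB hπ.2.le m

/-- The constant `32^{1/4} d^{3/4}`. -/
noncomputable def mainBound (d : ℕ) : ℝ := (32 : ℝ) ^ (1 / 4 : ℝ) * (d : ℝ) ^ (3 / 4 : ℝ)

theorem rpow_three_quarters_pow (d : ℕ) : ((d : ℝ) ^ (3 / 4 : ℝ)) ^ 4 = (d : ℝ) ^ 3 := by
  rw [← Real.rpow_natCast, ← Real.rpow_mul (Nat.cast_nonneg d), ← Real.rpow_natCast]
  norm_num

theorem mainBound_nonneg (d : ℕ) : 0 ≤ mainBound d := by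
  unfold mainBound; positivity

theorem mainBound_pow (d : ℕ) : mainBound d ^ 4 = 32 * (d : ℝ) ^ 3 := by
  rw [mainBound, mul_pow, rpow_three_quarters_pow, ← Real.rpow_natCast,
    ← Real.rpow_mul (by norm_num)]
  norm_num

theorem mainBound_pos (hd : 0 < d) : 0 < mainBound d := by
  have : (0 : ℝ) < d := Nat.cast_pos.2 hd
  unfold mainBound; positivity

theorem mainBound_lt (hd : 0 < d) : mainBound d < 3 * (d : ℝ) ^ (3 / 4 : ℝ) := by
  have hd0 : (0 : ℝ) < d := Nat.cast_pos.2 hd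
  refine lt_of_pow_lt_pow_left₀ 4 (by positivity) ?_
  rw [mainBound_pow, mul_pow, rpow_three_quarters_pow]
  have : (0 : ℝ) < (d : ℝ) ^ 3 := by positivity
  linarith

/-- In fourth powers this is `16 d^4 ≤ 32 d^3`. It covers exactly the degrees where `d/2 ≤ 1` and no
balancing `k` exists. -/
theorem two_mul_le_mainBound (hd : d ≤ 2) : (2 * d : ℝ) ≤ mainBound d := by
  refine le_of_pow_le_pow_left₀ (n := 4) (by norm_num) (mainBound_nonneg d) ?_
  rw [mainBound_pow]
  have hd' : (d : ℝ) ≤ 2 := by exact_mod_cast hd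
  have : (0 : ℝ) ≤ (d : ℝ) ^ 3 := by positivity
  nlinarith

/-- With `n^2` between consecutive powers of `d/2`, both error terms compare with `mainBound d ^
(2k)`, through `32 d^3 = (8d)^2 (d/2)` and `(2d)^4 = 32 d^3 (d/2)`. Rounding `k` to an integer costs
only a factor depending on `d`. -/
theorem expectation_muProduct_pow_le {n k : ℕ} (hd : 2 < d) (hk : k ≠ 0) (hkn : 4 * k ≤ n)
    (h1 : (d / 2 : ℝ) ^ k ≤ (n : ℝ) ^ 2) (h2 : (n : ℝ) ^ 2 < (d / 2 : ℝ) ^ (k + 1))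
    (σ : Fin d → Equiv.Perm V) :
    expectation (fun π : Fin d → Equiv.Perm (Fin n) => muProduct σ π ^ (2 * k))
      ≤ mainBound d ^ (2 * k) * (Fintype.card V * (27 * d + 96) * k ^ 4) := by
  have hN := card_perms_pos d n
  have hd1 : (1 : ℝ) ≤ d := by exact_mod_cast (by omega : 1 ≤ d)
  have hk1 : (1 : ℝ) ≤ k := by exact_mod_cast (by omega : 1 ≤ k)
  have hn : (0 : ℝ) < n := Nat.cast_pos.2 (by omega)
  have hβ : 0 ≤ mainBound d ^ (2 * k) := pow_nonneg (mainBound_nonneg d) _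
  have hβ2 : (mainBound d ^ (2 * k)) ^ 2 = (32 * (d : ℝ) ^ 3) ^ k := by
    rw [← mainBound_pow, ← pow_mul, ← pow_mul]; ring_nf
  have e1 : (8 * d : ℝ) ^ k * n ≤ d * mainBound d ^ (2 * k) := by
    refine le_of_pow_le_pow_left₀ (n := 2) (by norm_num) (by positivity) ?_
    rw [mul_pow _ (n : ℝ), mul_pow (d : ℝ), hβ2]
    calc ((8 * d : ℝ) ^ k) ^ 2 * (n : ℝ) ^ 2
        ≤ ((8 * d : ℝ) ^ k) ^ 2 * (d / 2 : ℝ) ^ (k + 1) := by gcongr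
      _ = (d / 2 : ℝ) * (32 * (d : ℝ) ^ 3) ^ k := by
          rw [show (32 * (d : ℝ) ^ 3) = (8 * d) ^ 2 * (d / 2) by ring, mul_pow _ (d / 2 : ℝ),
            pow_succ, ← pow_mul, ← pow_mul, mul_comm 2 k]
          ring
      _ ≤ (d : ℝ) ^ 2 * (32 * (d : ℝ) ^ 3) ^ k := by
          gcongr
          nlinarith
  have e2 : (2 * d : ℝ) ^ (2 * k) ≤ mainBound d ^ (2 * k) * n := by
    refine le_of_pow_le_pow_left₀ (n := 2) (by norm_num) (by positivity) ?_
    rw [mul_pow _ (n : ℝ), hβ2]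
    calc ((2 * d : ℝ) ^ (2 * k)) ^ 2 = (32 * (d : ℝ) ^ 3) ^ k * (d / 2 : ℝ) ^ k := by
          rw [← mul_pow, ← pow_mul, show 2 * k * 2 = 4 * k by ring, pow_mul]
          congr 1
          ring
      _ ≤ _ := by gcongr
  have e3 : (2 * k + 1 : ℝ) ^ 3 ≤ 27 * k ^ 4 := by
    calc (2 * k + 1 : ℝ) ^ 3 ≤ (3 * k : ℝ) ^ 3 := by gcongr; linarith
      _ = 27 * (k : ℝ) ^ 3 := by ring
      _ ≤ 27 * (k : ℝ) ^ 4 := by gcongr; norm_num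
  have hsum := sum_muProduct_pow_le (by omega) hk hkn σ
  rw [expectation, div_le_iff₀ hN, mul_comm _ (Fintype.card _ : ℝ)]
  refine hsum.trans (mul_le_mul_of_nonneg_left ?_ hN.le)
  calc (Fintype.card V * ((2 * k + 1) ^ 3 * (8 * d) ^ k * n
        + (2 * d) ^ (2 * k) * (96 * k ^ 4 / n)) : ℝ)
      = Fintype.card V * ((2 * k + 1) ^ 3 * ((8 * d) ^ k * n)
        + (2 * d) ^ (2 * k) * (96 * k ^ 4 / n)) := by ring
    _ ≤ Fintype.card V * ((27 * k ^ 4) * (d * mainBound d ^ (2 * k))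
        + (mainBound d ^ (2 * k) * n) * (96 * k ^ 4 / n)) := by gcongr
    _ = _ := by field_simp

theorem eventually_exists_moment_le (hd : 2 < d) (σ : Fin d → Equiv.Perm V) {p : ℕ → Prop}
    (hp : ∀ᶠ k in atTop, p k) :
    ∀ᶠ n : ℕ in atTop, ∃ k : ℕ, k ≠ 0 ∧ p k ∧
      expectation (fun π : Fin d → Equiv.Perm (Fin n) => muProduct σ π ^ (2 * k))
        ≤ mainBound d ^ (2 * k) * (Fintype.card V * (27 * d + 96) * k ^ 4) := by
  have hd2 : (2 : ℝ) < d := by exact_mod_cast hd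
  have hy : (1 : ℝ) < d / 2 := by linarith
  obtain ⟨K, hK⟩ := eventually_atTop.1
    ((hp.and (eventually_mul_pow_lt_pow 16 2 hy)).and (eventually_ge_atTop 1))
  have hlim : Tendsto (fun n : ℕ => (n : ℝ) ^ 2) atTop atTop :=
    (tendsto_pow_atTop (by norm_num)).comp tendsto_natCast_atTop_atTop
  filter_upwards [hlim.eventually_ge_atTop ((d / 2 : ℝ) ^ (K + 1)), eventually_ge_atTop 1]
    with n hn hn1
  have hn1' : (1 : ℝ) ≤ n := by exact_mod_cast hn1
  -- So `k` is the integer part of `2 log n / log (d/2)`. It exceeds `K` for large `n`, and then `16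
  -- k^2 < (d/2)^k ≤ n^2` gives `4k ≤ n`.
  obtain ⟨k, hk1, hk2⟩ := exists_nat_pow_near (one_le_pow₀ hn1' : (1 : ℝ) ≤ (n : ℝ) ^ 2) hy
  have hKk : K + 1 < k + 1 := (pow_lt_pow_iff_right₀ hy).1 (hn.trans_lt hk2)
  obtain ⟨⟨hpk, hk16⟩, hk0⟩ := hK k (by omega)
  have h4 : (4 * k : ℝ) ≤ n := by
    refine le_of_pow_le_pow_left₀ (n := 2) (by norm_num) (by positivity) ?_
    nlinarith
  exact ⟨k, by omega, hpk,
    expectation_muProduct_pow_le hd (by omega) (by exact_mod_cast h4) hk1 hk2 σ⟩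

theorem eventually_expectation_muProduct_lt (σ : Fin d → Equiv.Perm V) {δ : ℝ} (hδ : 0 < δ) :
    ∀ᶠ n : ℕ in atTop,
      expectation (fun π : Fin d → Equiv.Perm (Fin n) => muProduct σ π) < mainBound d + δ := by
  rcases le_or_gt d 2 with hd | hd
  · refine Eventually.of_forall fun n => ?_
    have h := expectation_le_of_le (n := n) (muProduct_le σ)
    linarith [two_mul_le_mainBound hd]
  have hβ : 0 < mainBound d := mainBound_pos (by omega)
  have hr : 1 < ((mainBound d + δ) / mainBound d) ^ 2 :=
    one_lt_pow₀ ((one_lt_div hβ).2 (by linarith)) (by norm_num)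
  -- The slack `δ` gains a factor exponential in `k`, which absorbs `|V|` and the polynomial factor.
  filter_upwards [eventually_exists_moment_le hd σ
    (eventually_mul_pow_lt_pow (Fintype.card V * (27 * d + 96)) 4 hr)] with n hn
  obtain ⟨k, -, hk, hmom⟩ := hn
  refine lt_of_pow_lt_pow_left₀ (2 * k) (by positivity) ?_
  calc _ ≤ _ := expectation_pow_le (2 * k) (muProduct_nonneg σ)
    _ ≤ _ := hmom
    _ < mainBound d ^ (2 * k) * (((mainBound d + δ) / mainBound d) ^ 2) ^ k :=
        mul_lt_mul_of_pos_left hk (by positivity)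
    _ = _ := by rw [← pow_mul, ← mul_pow, mul_div_cancel₀ _ hβ.ne']

theorem tendsto_probability_muProduct_le (σ : Fin d → Equiv.Perm V) :
    Tendsto (fun n : ℕ => probability fun π : Fin d → Equiv.Perm (Fin n) =>
      muProduct σ π ≤ 3 * (d : ℝ) ^ (3 / 4 : ℝ)) atTop (𝓝 1) := by
  rcases le_or_gt d 2 with hd | hd
  · refine tendsto_const_nhds.congr fun n => (probability_eq_one fun π => ?_).symm
    -- The strict comparison with the constant `3`, from `32 < 3^4`, fails at `d = 0`, where both
    -- sides vanish.
    rcases Nat.eq_zero_or_pos d with rfl | hd0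
    · simpa using muProduct_le σ π
    · exact (muProduct_le σ π).trans ((two_mul_le_mainBound hd).trans (mainBound_lt hd0).le)
  have hβ : 0 < mainBound d := mainBound_pos (by omega)
  set B : ℝ := 3 * (d : ℝ) ^ (3 / 4 : ℝ) with hB
  have hβB : mainBound d < B := mainBound_lt (by omega)
  have hB0 : 0 < B := hβ.trans hβB
  refine tendsto_order.2 ⟨fun a ha => ?_, fun a ha =>
    Eventually.of_forall fun n => (probability_le_one _).trans_lt ha⟩
  have hδ : 0 < 1 - a := by linarith
  have hr : 1 < (B / mainBound d) ^ 2 := one_lt_pow₀ ((one_lt_div hβ).2 hβB) (by norm_num)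
  filter_upwards [eventually_exists_moment_le hd σ (eventually_mul_pow_lt_pow
    (Fintype.card V * (27 * d + 96) / (1 - a)) 4 hr)] with n hn
  obtain ⟨k, -, hk, hmom⟩ := hn
  rw [div_mul_eq_mul_div, div_lt_iff₀ hδ] at hk
  have h : (1 - probability fun π : Fin d → Equiv.Perm (Fin n) => muProduct σ π ≤ B) * B ^ (2 * k)
      < (1 - a) * B ^ (2 * k) := by
    calc _ ≤ _ := one_sub_probability_mul_le (2 * k) (muProduct_nonneg σ) hB0.le
      _ ≤ _ := hmom
      _ < mainBound d ^ (2 * k) * (((B / mainBound d) ^ 2) ^ k * (1 - a)) :=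
          mul_lt_mul_of_pos_left hk (by positivity)
      _ = _ := by rw [← mul_assoc, ← pow_mul, ← mul_pow, mul_div_cancel₀ _ hβ.ne', mul_comm]
  have := lt_of_mul_lt_mul_right h (by positivity)
  linarith

end Asymptotics

end TightProduct

theorem mainTheorem5 :
    (∀ (d : ℕ) (V : Type*) [Fintype V] [DecidableEq V] (σ : Fin d → Equiv.Perm V),
      ∃ ε : ℕ → ℝ, Tendsto ε atTop (𝓝 0) ∧
        ∀ n : ℕ, TightProduct.expectation
            (fun π : Fin d → Equiv.Perm (Fin n) => TightProduct.muProduct σ π)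
          ≤ (32 : ℝ) ^ (1 / 4 : ℝ) * (d : ℝ) ^ (3 / 4 : ℝ) + ε n) ∧
    (∃ C : ℝ, ∀ (d : ℕ) (V : Type*) [Fintype V] [DecidableEq V] (σ : Fin d → Equiv.Perm V),
      Tendsto (fun n : ℕ => TightProduct.probability
          (fun π : Fin d → Equiv.Perm (Fin n) =>
            TightProduct.muProduct σ π ≤ C * (d : ℝ) ^ (3 / 4 : ℝ)))
        atTop (𝓝 1)) := by
  refine ⟨fun d V _ _ σ => ?_, 3, fun d V _ _ σ =>
    TightProduct.tendsto_probability_muProduct_le σ⟩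
  -- Only an upper bound is proved, so the error is the positive part of the excess.
  refine ⟨fun n => max 0 (TightProduct.expectation
    (fun π : Fin d → Equiv.Perm (Fin n) => TightProduct.muProduct σ π)
      - TightProduct.mainBound d), ?_, fun n => ?_⟩
  · refine tendsto_order.2 ⟨fun a ha => Eventually.of_forall fun n => ha.trans_le (le_max_left _ _),
      fun a ha => ?_⟩
    filter_upwards [TightProduct.eventually_expectation_muProduct_lt σ ha] with n hn
    exact max_lt ha (by linarith)
  · have := le_max_right 0 (TightProduct.expectation
      (fun π : Fin d → Equiv.Perm (Fin n) => TightProduct.muProduct σ π)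
        - TightProduct.mainBound d)
    rw [TightProduct.mainBound] at this ⊢
    linarith
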